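/- Let $\mathcal H_A,\mathcal H_B$ be finite-dimensional Hilbert spaces with fixed computational bases, and for each of the systems $X\in\{A,B,AB\}$, with dimension $d_X$ (so $d_{AB}=d_Ad_B$; the basis of $AB$ is the product basis), let $\mathcal E_X$ be a unitary 3-design on $\mathcal H_X$, i.e. a probability distribution on the unitary group for which $\Phi^3_X(Q):=\mathbb E_{U\sim\mathcal E_X}\,U^{\otimes3}Q\,U^{\dagger\otimes3}$ equals the corresponding Haar average for every operator $Q$ on $\mathcal H_X^{\otimes3}$ (for instance the Haar measure itself). Let $\Phi^3_A\otimes\Phi^3_B$ denote the bi-local twirling, i.e. the average over independent $U_A\sim\mathcal E_A$, $U_B\sim\mathcal E_B$ of conjugation by $(U_A\otimes U_B)^{\otimes3}$. For a permutation $\pi\in S_3$ let $W_\pi|s_1,s_2,s_3\rangle=|s_{\pi(1)},s_{\pi(2)},s_{\pi(3)}\rangle$, and put $M_+^X=W^X_{(1,2,3)}+W^X_{(1,3,2)}$ and $$M_{neg}=\tfrac12\bigl(W_{(1,2,3)}^A\otimes W_{(1,3,2)}^B+W_{(1,3,2)}^A\otimes W_{(1,2,3)}^B\bigr).$$ Let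 $O_+^X=\sum_{s,s',s''}O^X_+(s,s',s'')\,|s,s',s''\rangle\langle s,s',s''|$ be the diagonal observable on $\mathcal H_X^{\otimes3}$ with $$O^X_+(s,s',s'')=(d_X+1)(d_X+2)\,\delta_{ss's''}-(d_X+1)\,(\delta_{ss'}+\delta_{s's''}+\delta_{ss''})+2 .$$ Then: 1. $\Phi^3_A(O_+^A)=M_+^A$ and $\Phi^3_B(O_+^B)=M_+^B$; 2. $(\Phi^3_A\otimes\Phi^3_B)(O_+^A\otimes O_+^B)=M_+^A\otimes M_+^B$; 3. $\Phi^3_{AB}(O_+^{AB})=M_+^{AB}$; 4. $\tfrac12\bigl[(\Phi^3_A\otimes\Phi^3_B)(O_+^A\otimes O_+^B)-\Phi^3_{AB}(O_+^{AB})\bigr]=M_{neg}$; 5. for every state $\rho$ on $\mathcal H_A\otimes\mathcal H_B$ with partial transpose $\rho^{T_B}$, $$\mathrm{Tr}\Bigl[\tfrac12\bigl((\Phi^3_A\otimes\Phi^3_B)(O_+^A\otimes O_+^B)-\Phi^3_{AB}(O_+^{AB})\bigr)\rho^{\otimes3}\Bigr]=\mathrm{Tr}\bigl[(\rho^{T_B})^3\bigr],$$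 and, in terms of the outcome probabilities $P(a,b|U_A,U_B)=\langle a,b|(U_A\otimes U_B)\rho(U_A\otimes U_B)^\dagger|a,b\rangle$ and $P(c|U)=\langle c|U\rho U^\dagger|c\rangle$, $$\tfrac12\Bigl[\sum_{\vec a,\vec b}O^A_+(\vec a)O^B_+(\vec b)\,\mathbb E_{U_A,U_B}\prod_{i=1}^3P(a_i,b_i|U_A,U_B)-\sum_{\vec c}O_+^{AB}(\vec c)\,\mathbb E_{U\sim\mathcal E_{AB}}\prod_{i=1}^3P(c_i|U)\Bigr]=\mathrm{Tr}\bigl[(\rho^{T_B})^3\bigr].$$ -/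

import Mathlib

open MeasureTheory Matrix
open scoped Kronecker ComplexOrder

namespace NegMoment

noncomputable section

/-! ### The unitary group and its Haar probability measure

The Hilbert space is `ℂ^ι`, where the finite type `ι` labels the computational basis;
its dimension is `Fintype.card ι`. -/

instance instMeasurableSpaceUnitary (ι : Type*) [Fintype ι] [DecidableEq ι] :
    MeasurableSpace (unitaryGroup ι ℂ) := borel _

instance instBorelSpaceUnitary (ι : Type*) [Fintype ι] [DecidableEq ι] :
    BorelSpace (unitaryGroup ι ℂ) := ⟨rfl⟩

instance instCompactSpaceUnitary (ι : Type*) [Fintype ι] [DecidableEq ι] :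
    CompactSpace (unitaryGroup ι ℂ) := by
  have hb : IsCompact (Set.pi Set.univ fun _ : ι => Set.pi Set.univ fun _ : ι =>
      Metric.closedBall (0 : ℂ) 1) :=
    isCompact_univ_pi fun _ => isCompact_univ_pi fun _ => isCompact_closedBall _ _
  have hc : IsClosed {U : Matrix ι ι ℂ | star U * U = 1 ∧ U * star U = 1} := by
    refine IsClosed.inter ?_ ?_
    · exact isClosed_eq (by fun_prop) continuous_const
    · exact isClosed_eq (by fun_prop) continuous_const
  refine isCompact_iff_compactSpace.mp
    (IsCompact.of_isClosed_subset (s := (_ : Set (Matrix ι ι ℂ))) hb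
      (t := {U : Matrix ι ι ℂ | star U * U = 1 ∧ U * star U = 1}) hc ?_)
  intro U hU i _ j _
  simpa using entry_norm_bound_of_unitary (𝕜 := ℂ) (U := U) hU i j

/-- The Haar probability measure on the unitary group of `ℂ^ι`. -/
def haarUnitary (ι : Type*) [Fintype ι] [DecidableEq ι] : Measure (unitaryGroup ι ℂ) :=
  Measure.haarMeasure ⊤

instance instIsProbabilityMeasureHaarUnitary (ι : Type*) [Fintype ι] [DecidableEq ι] :
    IsProbabilityMeasure (haarUnitary ι) :=
  ⟨Measure.haarMeasure_self (K₀ := (⊤ : TopologicalSpace.PositiveCompacts (unitaryGroup ι ℂ)))⟩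

/-! ### Operators on `k` copies -/

/-- The `k`-fold tensor power `X^{⊗k}`, in the product basis `|s⟩ = |s₀,…,s_{k-1}⟩`. -/
def tensorPow {ι : Type*} (k : ℕ) (X : Matrix ι ι ℂ) :
    Matrix (Fin k → ι) (Fin k → ι) ℂ :=
  Matrix.of fun s t => ∏ i, X (s i) (t i)

/-- The permutation operator `W_π = ∑ₛ |s_{π(1)},…,s_{π(k)}⟩⟨s₁,…,s_k|`. -/
def permOp (ι : Type*) [DecidableEq ι] {k : ℕ} (π : Equiv.Perm (Fin k)) :
    Matrix (Fin k → ι) (Fin k → ι) ℂ :=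
  Matrix.of fun t s => if t = s ∘ π then 1 else 0

/-- For `X` on `k` copies of `A` and `Y` on `k` copies of `B`, the operator `X ⊗ Y`
on `k` copies of `AB`. -/
def tensorAB {A B : Type*} {k : ℕ} (X : Matrix (Fin k → A) (Fin k → A) ℂ)
    (Y : Matrix (Fin k → B) (Fin k → B) ℂ) :
    Matrix (Fin k → A × B) (Fin k → A × B) ℂ :=
  (X ⊗ₖ Y).submatrix (fun s => (fun i => (s i).1, fun i => (s i).2))
    (fun s => (fun i => (s i).1, fun i => (s i).2))

/-! ### Twirling -/

/-- The twirling map `X ↦ 𝔼_{U ∼ μ} U^{⊗k} X (U†)^{⊗k}` (entrywise integral). -/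
def twirl {ι : Type*} [Fintype ι] [DecidableEq ι] (k : ℕ) (μ : Measure (unitaryGroup ι ℂ))
    (X : Matrix (Fin k → ι) (Fin k → ι) ℂ) : Matrix (Fin k → ι) (Fin k → ι) ℂ :=
  Matrix.of fun s t =>
    ∫ U, (tensorPow k (U : Matrix ι ι ℂ) * X * tensorPow k (U : Matrix ι ι ℂ)ᴴ) s t ∂μ

/-- `μ` is (the law of) a unitary `k`-design: its `k`-fold twirling map is that of Haar. -/
structure IsUnitaryDesign {ι : Type*} [Fintype ι] [DecidableEq ι] (k : ℕ)
    (μ : Measure (unitaryGroup ι ℂ)) : Prop where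
  isProbabilityMeasure : IsProbabilityMeasure μ
  twirl_eq : ∀ X : Matrix (Fin k → ι) (Fin k → ι) ℂ, twirl k μ X = twirl k (haarUnitary ι) X

theorem isUnitaryDesign_haarUnitary (ι : Type*) [Fintype ι] [DecidableEq ι] (k : ℕ) :
    IsUnitaryDesign k (haarUnitary ι) :=
  ⟨inferInstance, fun _ => rfl⟩

/-- The bi-local twirling map `Φ_A ⊗ Φ_B`: conjugation by `(U_A ⊗ U_B)^{⊗k}`, averaged over
independent `U_A ∼ μA`, `U_B ∼ μB`. -/
def bilocalTwirl {A B : Type*} [Fintype A] [DecidableEq A] [Fintype B] [DecidableEq B] (k : ℕ)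
    (μA : Measure (unitaryGroup A ℂ)) (μB : Measure (unitaryGroup B ℂ))
    (X : Matrix (Fin k → A × B) (Fin k → A × B) ℂ) :
    Matrix (Fin k → A × B) (Fin k → A × B) ℂ :=
  Matrix.of fun s t =>
    ∫ U, (tensorPow k ((U.1 : Matrix A A ℂ) ⊗ₖ (U.2 : Matrix B B ℂ)) * X *
      tensorPow k ((U.1 : Matrix A A ℂ) ⊗ₖ (U.2 : Matrix B B ℂ))ᴴ) s t ∂(μA.prod μB)

/-! ### The observables -/

/-- `O_+(s,s',s'') = (d+1)(d+2) δ_{ss's''} - (d+1)(δ_{ss'} + δ_{s's''} + δ_{ss''}) + 2`. -/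
def oPlusCoeff {ι : Type*} [Fintype ι] [DecidableEq ι] (s : Fin 3 → ι) : ℂ :=
  ((Fintype.card ι : ℂ) + 1) * ((Fintype.card ι : ℂ) + 2) *
      (if s 0 = s 1 ∧ s 1 = s 2 then 1 else 0)
    - ((Fintype.card ι : ℂ) + 1) *
      ((if s 0 = s 1 then 1 else 0) + (if s 1 = s 2 then 1 else 0) +
        (if s 0 = s 2 then 1 else 0))
    + 2

/-- The diagonal observable `O_+ = ∑ₛ O_+(s) |s⟩⟨s|` on three copies. -/
def oPlus (ι : Type*) [Fintype ι] [DecidableEq ι] : Matrix (Fin 3 → ι) (Fin 3 → ι) ℂ :=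
  Matrix.diagonal oPlusCoeff

/-- The cyclic operator `W_(123)`; it sends `|a₁,a₂,a₃⟩` to `|a₂,a₃,a₁⟩`. -/
def w123 (ι : Type*) [DecidableEq ι] : Matrix (Fin 3 → ι) (Fin 3 → ι) ℂ :=
  permOp ι c[(0 : Fin 3), 1, 2]

/-- The cyclic operator `W_(132)`. -/
def w132 (ι : Type*) [DecidableEq ι] : Matrix (Fin 3 → ι) (Fin 3 → ι) ℂ :=
  permOp ι c[(0 : Fin 3), 2, 1]

/-- `M_+ = W_(123) + W_(132)`. -/
def mPlus (ι : Type*) [DecidableEq ι] : Matrix (Fin 3 → ι) (Fin 3 → ι) ℂ :=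
  w123 ι + w132 ι

/-- `M_neg = ½ (W_(123)^A ⊗ W_(132)^B + W_(132)^A ⊗ W_(123)^B)`. -/
def mNeg (A B : Type*) [DecidableEq A] [DecidableEq B] :
    Matrix (Fin 3 → A × B) (Fin 3 → A × B) ℂ :=
  (1 / 2 : ℂ) • (tensorAB (w123 A) (w132 B) + tensorAB (w132 A) (w123 B))

/-! ### States, partial transpose, and measurement statistics -/

/-- Density operators. -/
structure IsState {ι : Type*} [Fintype ι] (ρ : Matrix ι ι ℂ) : Prop where
  posSemidef : ρ.PosSemidef
  trace_eq_one : ρ.trace = 1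

/-- The partial transpose `ρ^{T_B}`: `⟨a,b|ρ^{T_B}|a',b'⟩ = ⟨a,b'|ρ|a',b⟩`. -/
def partialTranspose {A B : Type*} (ρ : Matrix (A × B) (A × B) ℂ) :
    Matrix (A × B) (A × B) ℂ :=
  Matrix.of fun x y => ρ (x.1, y.2) (y.1, x.2)

/-- `Tr[|s⟩⟨s| U ρ U†]`, the probability of outcome `s` when `U ρ U†` is measured in the
computational basis. -/
def outcomeProb {ι : Type*} [Fintype ι] [DecidableEq ι] (ρ U : Matrix ι ι ℂ) (s : ι) : ℂ :=
  (Matrix.single s s 1 * (U * ρ * Uᴴ)).trace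

/-- `Ω(s,ρ) = 𝔼_U P(s₁|U) P(s₂|U) P(s₃|U)` in the (global) random unitary scheme. -/
def globalOmega {ι : Type*} [Fintype ι] [DecidableEq ι] (μ : Measure (unitaryGroup ι ℂ))
    (ρ : Matrix ι ι ℂ) (s : Fin 3 → ι) : ℂ :=
  ∫ U, ∏ i, outcomeProb ρ (U : Matrix ι ι ℂ) (s i) ∂μ

/-- `Ω(a,b,ρ) = 𝔼_{U_A,U_B} ∏ᵢ P(aᵢ,bᵢ|U_A,U_B)` in the bi-local random unitary scheme. -/
def bilocalOmega {A B : Type*} [Fintype A] [DecidableEq A] [Fintype B] [DecidableEq B]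
    (μA : Measure (unitaryGroup A ℂ)) (μB : Measure (unitaryGroup B ℂ))
    (ρ : Matrix (A × B) (A × B) ℂ) (a : Fin 3 → A) (b : Fin 3 → B) : ℂ :=
  ∫ U, ∏ i, outcomeProb ρ ((U.1 : Matrix A A ℂ) ⊗ₖ (U.2 : Matrix B B ℂ)) (a i, b i)
    ∂(μA.prod μB)

end

end NegMoment

/-! Since `O_+` is diagonal with coefficients built from Kronecker deltas, its Haar twirl needs no
full Weingarten calculus. Expanding the deltas leaves moments of a single column `U · j`, of degree
three or two in `U` and its conjugate; every remaining sum over a column index collapses by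
unitarity.

The third column moment is `colMoment j s t = N(s,t) / (d(d+1)(d+2))`, where `N = permCount` counts
the permutations taking `t` to `s` (`colMoment_eq`). Left invariance alone gives this: diagonal
phases kill the moment unless `s` rearranges `t`, permutation matrices and a Hadamard rotation of
two coordinates fix the ratios of the surviving moments, and `∑ |U i j|² = 1` fixes the scale.
Summing out one letter yields the second moment.

With these values the three parts of `O_+` twirl to (1 + three transpositions + two 3-cycles), -(3 +
three transpositions) and 2, so only the 3-cycles remain (`twirl_haarUnitary_oPlus`). The design
property transfers this from Haar. Independence makes the bi-local twirl factor, and subtracting the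
global `M_+` removes the two aligned pairs of cycles, leaving twice `M_neg`. Opposite cycles on `A`
and `B` are what the partial transpose produces in `Tr[(ρ^{T_B})³]`.

Outcome statistics involve `U†` on the left, hence the adjoint twirl; for a design it agrees with
the Haar twirl by trace duality. -/

namespace NegMoment

noncomputable section

/-! ### Integration of continuous functions over the unitary group -/

/-- Second countability makes the product σ-algebra on a pair of unitary groups Borel, so continuous
functions of `(U_A, U_B)` are measurable for the product measure. -/
instance instSecondCountableTopologyUnitary (ι : Type*) [Fintype ι] [DecidableEq ι] :
    SecondCountableTopology (unitaryGroup ι ℂ) :=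
  haveI : SecondCountableTopology (Matrix ι ι ℂ) :=
    inferInstanceAs (SecondCountableTopology (ι → ι → ℂ))
  inferInstanceAs (SecondCountableTopology
    {U : Matrix ι ι ℂ // U ∈ (unitaryGroup ι ℂ : Set (Matrix ι ι ℂ))})

theorem integrable_of_continuous {X : Type*} [TopologicalSpace X] [CompactSpace X]
    [MeasurableSpace X] [OpensMeasurableSpace X] (μ : Measure X) [IsFiniteMeasure μ]
    {f : X → ℂ} (hf : Continuous f) : Integrable f μ :=
  hf.integrable_of_hasCompactSupport (HasCompactSupport.of_compactSpace f)

/-! ### Permutations of three letters -/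

section Perm

variable {ι : Type*} [DecidableEq ι]

theorem sum_perm_fin_three {M : Type*} [AddCommMonoid M] (f : Equiv.Perm (Fin 3) → M) :
    ∑ π, f π = f 1 + f (Equiv.swap 0 1) + f (Equiv.swap 1 2) + f (Equiv.swap 0 2) +
      f c[0, 1, 2] + f c[0, 2, 1] := by
  have h : (Finset.univ : Finset (Equiv.Perm (Fin 3))) =
      {1, Equiv.swap 0 1, Equiv.swap 1 2, Equiv.swap 0 2, c[0, 1, 2], c[0, 2, 1]} := by decide
  rw [h, Finset.sum_insert (by decide), Finset.sum_insert (by decide),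
    Finset.sum_insert (by decide), Finset.sum_insert (by decide), Finset.sum_insert (by decide),
    Finset.sum_singleton]
  simp only [add_assoc]

/-- The number of permutations `π` with `s = t ∘ π`. -/
def permCount (s t : Fin 3 → ι) : ℂ := ∑ π : Equiv.Perm (Fin 3), if s = t ∘ π then 1 else 0

theorem fin_three_eq_iff {α : Type*} (s : Fin 3 → α) (x y z : α) :
    s = ![x, y, z] ↔ s 0 = x ∧ s 1 = y ∧ s 2 = z := by
  simp [funext_iff, Fin.forall_fin_succ]

theorem permCount_eq (s t : Fin 3 → ι) : permCount s t =
    (if s 0 = t 0 ∧ s 1 = t 1 ∧ s 2 = t 2 then 1 else 0) +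
    (if s 0 = t 1 ∧ s 1 = t 0 ∧ s 2 = t 2 then 1 else 0) +
    (if s 0 = t 0 ∧ s 1 = t 2 ∧ s 2 = t 1 then 1 else 0) +
    (if s 0 = t 2 ∧ s 1 = t 1 ∧ s 2 = t 0 then 1 else 0) +
    (if s 0 = t 1 ∧ s 1 = t 2 ∧ s 2 = t 0 then 1 else 0) +
    (if s 0 = t 2 ∧ s 1 = t 0 ∧ s 2 = t 1 then 1 else 0) := by
  have h : ∀ π : Equiv.Perm (Fin 3), t ∘ π = ![t (π 0), t (π 1), t (π 2)] := fun π => by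
    ext i; fin_cases i <;> rfl
  simp only [permCount, sum_perm_fin_three, h, fin_three_eq_iff]
  rfl

theorem permCount_cons (a b c x y z : ι) : permCount ![a, b, c] ![x, y, z] =
    (if a = x ∧ b = y ∧ c = z then 1 else 0) + (if a = y ∧ b = x ∧ c = z then 1 else 0) +
    (if a = x ∧ b = z ∧ c = y then 1 else 0) + (if a = z ∧ b = y ∧ c = x then 1 else 0) +
    (if a = y ∧ b = z ∧ c = x then 1 else 0) + (if a = z ∧ b = x ∧ c = y then 1 else 0) :=
  permCount_eq _ _

theorem permCount_comp_right (s t : Fin 3 → ι) (σ : Equiv.Perm (Fin 3)) :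
    permCount s (t ∘ σ) = permCount s t := by
  unfold permCount
  exact Equiv.sum_comp (Equiv.mulLeft σ) fun π => if s = t ∘ π then (1 : ℂ) else 0

theorem exists_comp_perm_of_card_eq {κ : Type*} [Fintype κ] [DecidableEq κ] {s t : κ → ι}
    (h : ∀ b, Fintype.card {i // s i = b} = Fintype.card {i // t i = b}) :
    ∃ π : Equiv.Perm κ, s = t ∘ π :=
  ⟨Equiv.ofFiberEquiv fun b => Fintype.equivOfCardEq (h b),
    funext fun i => (Equiv.ofFiberEquiv_map _ i).symm⟩

end Perm

/-! ### Haar averages: inversion invariance and unitarity relations -/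

section Haar

variable {ι : Type*} [Fintype ι] [DecidableEq ι]

instance : (haarUnitary ι).IsMulLeftInvariant := by
  unfold haarUnitary; infer_instance

/-- Integrate `f (U⁻¹ * V)` over both variables. The inner integral over `V` removes `U⁻¹` by left
invariance; the one over `U` absorbs `V` after `U ↦ V⁻¹⁻¹ * U`. Fubini equates the two results. -/
theorem integral_haarUnitary_inv {f : unitaryGroup ι ℂ → ℂ} (hf : Continuous f) :
    ∫ U, f U⁻¹ ∂haarUnitary ι = ∫ U, f U ∂haarUnitary ι := by
  have h := integral_integral_swap (μ := haarUnitary ι) (ν := haarUnitary ι)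
    (f := fun U V => f (U⁻¹ * V))
    (integrable_of_continuous _ (by fun_prop))
  have h1 : ∀ U : unitaryGroup ι ℂ,
      ∫ V, f (U⁻¹ * V) ∂haarUnitary ι = ∫ V, f V ∂haarUnitary ι :=
    fun U => integral_mul_left_eq_self f U⁻¹
  have h2 : ∀ V : unitaryGroup ι ℂ,
      ∫ U, f (U⁻¹ * V) ∂haarUnitary ι = ∫ U, f U⁻¹ ∂haarUnitary ι := fun V => by
    rw [← integral_mul_left_eq_self (fun U : unitaryGroup ι ℂ => f U⁻¹) V⁻¹]
    simp
  simp only [h1, h2, integral_const, probReal_univ, one_smul] at h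
  exact h.symm

/-- The Haar average as a linear functional on continuous functions. -/
def haarAverage (ι : Type*) [Fintype ι] [DecidableEq ι] : C(unitaryGroup ι ℂ, ℂ) →ₗ[ℂ] ℂ where
  toFun f := ∫ U, f U ∂haarUnitary ι
  map_add' f g := integral_add (integrable_of_continuous _ f.continuous)
    (integrable_of_continuous _ g.continuous)
  map_smul' c _ := integral_const_mul c _

theorem haarAverage_apply (f : C(unitaryGroup ι ℂ, ℂ)) :
    haarAverage ι f = ∫ U, f U ∂haarUnitary ι := rfl

theorem haarAverage_one : haarAverage ι 1 = 1 := by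
  simp [haarAverage_apply]

theorem haarAverage_of_mul_left {f g : C(unitaryGroup ι ℂ, ℂ)} (V : unitaryGroup ι ℂ)
    (h : ∀ U, f (V * U) = g U) : haarAverage ι f = haarAverage ι g := by
  rw [haarAverage_apply, haarAverage_apply, ← integral_mul_left_eq_self _ V]
  exact integral_congr_ae (.of_forall h)

/-- The matrix entry `U ↦ U i j` as a continuous function. -/
def entry (i j : ι) : C(unitaryGroup ι ℂ, ℂ) :=
  ⟨fun U => (U : Matrix ι ι ℂ) i j, continuous_subtype_val.matrix_elem i j⟩

theorem entry_apply (i j : ι) (U : unitaryGroup ι ℂ) : entry i j U = (U : Matrix ι ι ℂ) i j := rfl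

theorem sum_entry_mul_star_entry (i k : ι) :
    ∑ j, entry i j * star (entry k j) = if i = k then 1 else 0 := by
  ext U
  have h := congrFun (congrFun (mem_unitaryGroup_iff.mp U.2) i) k
  simp only [mul_apply, star_apply, one_apply] at h
  simp only [ContinuousMap.sum_apply, ContinuousMap.mul_apply, ContinuousMap.star_apply,
    entry_apply, h]
  split_ifs <;> simp

theorem sum_star_entry_mul_entry (j k : ι) :
    ∑ i, entry i j * star (entry i k) = if j = k then 1 else 0 := by
  ext U
  have h := congrFun (congrFun (mem_unitaryGroup_iff'.mp U.2) k) j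
  simp only [mul_apply, star_apply, one_apply] at h
  simp only [ContinuousMap.sum_apply, ContinuousMap.mul_apply, ContinuousMap.star_apply,
    entry_apply, mul_comm _ (star _), h, eq_comm (a := k)]
  split_ifs <;> simp

/-! ### Sixth moments of one column of a Haar random unitary -/

/-- `𝔼 ∏ᵢ U (sᵢ) j * conj (U (tᵢ) j)`. -/
def colMoment (j : ι) (s t : Fin 3 → ι) : ℂ :=
  haarAverage ι (∏ i, (entry (s i) j * star (entry (t i) j)))

theorem colMoment_comp_right (j : ι) (s t : Fin 3 → ι) (π : Equiv.Perm (Fin 3)) :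
    colMoment j s (t ∘ π) = colMoment j s t := by
  simp only [colMoment, Finset.prod_mul_distrib, Function.comp_apply,
    Equiv.prod_comp π (fun i => star (entry (t i) j))]

theorem colMoment_perm (j : ι) (σ : Equiv.Perm ι) (s t : Fin 3 → ι) :
    colMoment j (σ ∘ s) (σ ∘ t) = colMoment j s t := by
  have hV : (σ⁻¹.permMatrix ℂ) ∈ unitaryGroup ι ℂ := by
    rw [mem_unitaryGroup_iff, star_eq_conjTranspose, conjTranspose_permMatrix, ← permMatrix_mul]
    simp
  refine haarAverage_of_mul_left ⟨_, hV⟩ fun U => ?_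
  simp [entry_apply, PEquiv.toMatrix_toPEquiv_mul, Equiv.Perm.permMatrix]

theorem colMoment_diag {D : ι → ℂ} (hD : ∀ i, D i * star (D i) = 1) (j : ι) (s t : Fin 3 → ι) :
    colMoment j s t = (∏ i, D (s i)) * (∏ i, star (D (t i))) * colMoment j s t := by
  have hV : Matrix.diagonal D ∈ unitaryGroup ι ℂ := by
    rw [mem_unitaryGroup_iff, star_eq_conjTranspose, diagonal_conjTranspose, diagonal_mul_diagonal]
    simp only [Pi.star_apply, hD, diagonal_one]
  conv_rhs => rw [colMoment, ← smul_eq_mul, ← map_smul]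
  refine haarAverage_of_mul_left ⟨_, hV⟩ fun U => ?_
  simp only [ContinuousMap.prod_apply, ContinuousMap.mul_apply, ContinuousMap.star_apply,
    entry_apply, ContinuousMap.smul_apply, Submonoid.coe_mul, diagonal_mul, star_mul', smul_eq_mul,
    Finset.prod_mul_distrib]
  ring

/-- Rotating the phase of row `b` multiplies the moment by a factor that differs from 1 when `b`
occurs unequally often in `s` and `t`. -/
theorem colMoment_eq_zero_of_count_ne (j : ι) {s t : Fin 3 → ι} (b : ι)
    (hb : (∑ i, if s i = b then 1 else 0) ≠ ∑ i, if t i = b then 1 else 0) :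
    colMoment j s t = 0 := by
  -- The factor is `I ^ m * (-I) ^ n`. As `m, n ≤ 3`, a phase of order 4 already separates all
  -- unequal counts.
  have key := colMoment_diag (D := fun i => if i = b then Complex.I else 1)
    (fun i => by split_ifs <;> simp) j s t
  have h1 : ∀ (r : Fin 3 → ι) (c : ℂ), (∏ i, if r i = b then c else 1) =
      c ^ ∑ i, if r i = b then 1 else 0 := fun r c => by
    rw [← Finset.prod_pow_eq_pow_sum]
    exact Finset.prod_congr rfl fun i _ => by split_ifs <;> simp
  have h3 : ∀ r : Fin 3 → ι, (∑ i, if r i = b then 1 else 0) ≤ 3 := fun r =>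
    (Finset.sum_le_card_nsmul _ _ 1 fun i _ => by split_ifs <;> simp).trans (by simp)
  simp only [apply_ite star, star_one, h1] at key
  have hs := h3 s
  have ht := h3 t
  generalize (∑ i, if s i = b then 1 else 0) = m at *
  generalize (∑ i, if t i = b then 1 else 0) = n at *
  by_contra h0
  have key2 := mul_right_cancel₀ h0 ((one_mul _).trans key)
  interval_cases m <;> interval_cases n <;>
    first
    | exact hb rfl
    | (simp [Complex.ext_iff, pow_succ] at key2; try norm_num at key2)

theorem colMoment_eq_zero (j : ι) {s t : Fin 3 → ι} (h : ∀ π : Equiv.Perm (Fin 3), s ≠ t ∘ π) :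
    colMoment j s t = 0 := by
  have ⟨b, hb⟩ : ∃ b, Fintype.card {i // s i = b} ≠ Fintype.card {i // t i = b} := by
    by_contra! hc
    exact (exists_comp_perm_of_card_eq hc).elim h
  refine colMoment_eq_zero_of_count_ne j b ?_
  simpa [Fintype.card_subtype] using hb

/-- The diagonal moment `𝔼 |U a j|² |U b j|² |U c j|²`. -/
def diagMoment (j a b c : ι) : ℂ := colMoment j ![a, b, c] ![a, b, c]

theorem diagMoment_perm (j : ι) (σ : Equiv.Perm ι) (a b c : ι) :
    diagMoment j (σ a) (σ b) (σ c) = diagMoment j a b c := by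
  rw [diagMoment, diagMoment, ← colMoment_perm j σ ![a, b, c]]
  congr 1 <;> ext i <;> fin_cases i <;> rfl

theorem diagMoment_rotate (j a b c : ι) : diagMoment j a b c = diagMoment j b c a := by
  simp only [diagMoment, colMoment, Fin.prod_univ_three, cons_val]
  congr 1; ring

/-- The complex number `1 / √2`. -/
def invSqrtTwo : ℂ := (((√2)⁻¹ : ℝ) : ℂ)

theorem invSqrtTwo_sq : invSqrtTwo ^ 2 = 1 / 2 := by
  rw [invSqrtTwo, ← Complex.ofReal_pow, inv_pow, Real.sq_sqrt zero_le_two]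
  norm_num

theorem conj_invSqrtTwo : (starRingEnd ℂ) invSqrtTwo = invSqrtTwo := Complex.conj_ofReal _

/-- The unitary mixing the coordinates `a` and `b` by a Hadamard gate. -/
def hadamardAt (a b : ι) : Matrix ι ι ℂ :=
  1 + (single a a (invSqrtTwo - 1) + single a b invSqrtTwo + single b a invSqrtTwo +
    single b b (-invSqrtTwo - 1))

theorem hadamardAt_mem {a b : ι} (hab : a ≠ b) : hadamardAt a b ∈ unitaryGroup ι ℂ := by
  have hr := invSqrtTwo_sq
  have hstar : star (hadamardAt a b) = hadamardAt a b := by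
    simp only [hadamardAt, star_eq_conjTranspose, conjTranspose_add, conjTranspose_one,
      conjTranspose_single, star_sub, star_neg, star_one, Complex.star_def, conj_invSqrtTwo]
    abel
  rw [mem_unitaryGroup_iff, hstar, hadamardAt]
  generalize invSqrtTwo = r at hr
  simp only [add_mul, mul_add, one_mul, mul_one, single_mul_single_same,
    single_mul_single_of_ne _ _ _ _ hab, single_mul_single_of_ne _ _ _ _ hab.symm, add_zero, zero_add]
  ext i k
  simp only [Matrix.add_apply, single_apply]
  split_ifs <;> grind

theorem hadamardAt_mul_apply_left {a b : ι} (hab : a ≠ b) (U : Matrix ι ι ℂ) (j : ι) :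
    (hadamardAt a b * U) a j = invSqrtTwo * (U a j + U b j) := by
  simp [hadamardAt, add_mul, single_mul_apply_of_ne, hab]
  ring

theorem hadamardAt_mul_apply_of_ne {a b c : ι} (hca : c ≠ a) (hcb : c ≠ b) (U : Matrix ι ι ℂ)
    (j : ι) : (hadamardAt a b * U) c j = U c j := by
  simp [hadamardAt, add_mul, single_mul_apply_of_ne, hca, hcb]

/-- Invariance under the Hadamard rotation gives `𝔼|U a j|⁶ = 𝔼|U a j + U b j|⁶ / 8`. In the
expansion only terms with equal letter counts survive, weighted by squared binomials 1, 9, 9, 1; the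
swap of `a` and `b` identifies them in pairs. -/
theorem diagMoment_same (j : ι) {a b : ι} (hab : a ≠ b) :
    diagMoment j a a a = 3 * diagMoment j a a b := by
  set m : (Fin 3 → ι) → (Fin 3 → ι) → C(unitaryGroup ι ℂ, ℂ) :=
    fun s t => ∏ i, (entry (s i) j * star (entry (t i) j)) with hm
  have key : diagMoment j a a a = haarAverage ι ((1 / 8 : ℂ) •
      ((entry a j + entry b j) ^ 3 * (star (entry a j) + star (entry b j)) ^ 3)) := by
    refine (haarAverage_of_mul_left ⟨_, hadamardAt_mem hab⟩ fun U => ?_)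
    have hr := invSqrtTwo_sq
    simp [entry_apply, hadamardAt_mul_apply_left hab, conj_invSqrtTwo,
      Fin.prod_univ_three]
    generalize invSqrtTwo = r at hr
    grind
  have hexp : (entry a j + entry b j) ^ 3 * (star (entry a j) + star (entry b j)) ^ 3 =
      m ![a, a, a] ![a, a, a] + (9 : ℂ) • m ![a, a, b] ![a, a, b] + (9 : ℂ) • m ![b, b, a] ![b, b, a]
      + m ![b, b, b] ![b, b, b]
      + ((3 : ℂ) • m ![a, a, a] ![a, a, b] + (3 : ℂ) • m ![a, a, a] ![a, b, b]
        + m ![a, a, a] ![b, b, b] + (3 : ℂ) • m ![a, a, b] ![a, a, a]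
        + (9 : ℂ) • m ![a, a, b] ![a, b, b] + (3 : ℂ) • m ![a, a, b] ![b, b, b]
        + (3 : ℂ) • m ![a, b, b] ![a, a, a] + (9 : ℂ) • m ![a, b, b] ![a, a, b]
        + (3 : ℂ) • m ![a, b, b] ![b, b, b] + m ![b, b, b] ![a, a, a]
        + (3 : ℂ) • m ![b, b, b] ![a, a, b] + (3 : ℂ) • m ![b, b, b] ![a, b, b]) := by
    ext U
    simp [hm, Fin.prod_univ_three]
    ring
  have hz : ∀ x y z x' y' z' : ι, ((if x = b then 1 else 0) + (if y = b then 1 else 0) +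
      (if z = b then 1 else 0) ≠ (if x' = b then 1 else 0) + (if y' = b then 1 else 0) +
      (if z' = b then 1 else 0)) → haarAverage ι (m ![x, y, z] ![x', y', z']) = 0 :=
    fun x y z x' y' z' h => colMoment_eq_zero_of_count_ne j b (by rwa [Fin.sum_univ_three, Fin.sum_univ_three])
  have hd : ∀ x y z, haarAverage ι (m ![x, y, z] ![x, y, z]) = diagMoment j x y z :=
    fun _ _ _ => rfl
  have h1 : diagMoment j b b b = diagMoment j a a a := by
    simpa using diagMoment_perm j (Equiv.swap a b) a a a
  have h2 : diagMoment j b b a = diagMoment j a a b := by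
    simpa using diagMoment_perm j (Equiv.swap a b) a a b
  rw [hexp] at key
  simp (discharger := simp [hab]) only [map_add, map_smul, hd, hz] at key
  rw [h1, h2] at key
  simp only [smul_eq_mul] at key
  linear_combination (4 / 3) * key

/-- The same rotation with a spectator row `c`: now the weights are 1, 4, 1 and the prefactor is
1/4. -/
theorem diagMoment_pair (j : ι) {a b c : ι} (hab : a ≠ b) (hca : c ≠ a) (hcb : c ≠ b) :
    diagMoment j a a c = 2 * diagMoment j a b c := by
  set m : (Fin 3 → ι) → (Fin 3 → ι) → C(unitaryGroup ι ℂ, ℂ) :=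
    fun s t => ∏ i, (entry (s i) j * star (entry (t i) j)) with hm
  have key : diagMoment j a a c = haarAverage ι ((1 / 4 : ℂ) •
      ((entry a j + entry b j) ^ 2 * (star (entry a j) + star (entry b j)) ^ 2 *
        (entry c j * star (entry c j)))) := by
    refine (haarAverage_of_mul_left ⟨_, hadamardAt_mem hab⟩ fun U => ?_)
    have hr := invSqrtTwo_sq
    simp [entry_apply, hadamardAt_mul_apply_left hab, conj_invSqrtTwo, hadamardAt_mul_apply_of_ne hca hcb,
      Fin.prod_univ_three]
    generalize invSqrtTwo = r at hr
    grind
  have hexp : (entry a j + entry b j) ^ 2 * (star (entry a j) + star (entry b j)) ^ 2 *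
        (entry c j * star (entry c j)) =
      m ![a, a, c] ![a, a, c] + (4 : ℂ) • m ![a, b, c] ![a, b, c] + m ![b, b, c] ![b, b, c]
      + ((2 : ℂ) • m ![a, a, c] ![a, b, c] + m ![a, a, c] ![b, b, c]
        + (2 : ℂ) • m ![a, b, c] ![a, a, c] + (2 : ℂ) • m ![a, b, c] ![b, b, c]
        + m ![b, b, c] ![a, a, c] + (2 : ℂ) • m ![b, b, c] ![a, b, c]) := by
    ext U
    simp [hm, Fin.prod_univ_three]
    ring
  have hz : ∀ x y z x' y' z' : ι, ((if x = b then 1 else 0) + (if y = b then 1 else 0) +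
      (if z = b then 1 else 0) ≠ (if x' = b then 1 else 0) + (if y' = b then 1 else 0) +
      (if z' = b then 1 else 0)) → haarAverage ι (m ![x, y, z] ![x', y', z']) = 0 :=
    fun x y z x' y' z' h => colMoment_eq_zero_of_count_ne j b (by rwa [Fin.sum_univ_three, Fin.sum_univ_three])
  have hd : ∀ x y z, haarAverage ι (m ![x, y, z] ![x, y, z]) = diagMoment j x y z :=
    fun _ _ _ => rfl
  have h2 : diagMoment j b b c = diagMoment j a a c := by
    simpa [Equiv.swap_apply_of_ne_of_ne hca hcb] using diagMoment_perm j (Equiv.swap a b) a a c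
  rw [hexp] at key
  simp (discharger := simp [hab, hcb]) only [map_add, map_smul, hd, hz] at key
  rw [h2] at key
  simp only [smul_eq_mul] at key
  linear_combination 2 * key

/-- The ratios 6 : 2 : 1 for three, two or no coinciding letters are the stabilizer orders of the
string in `S₃`, which is what `permCount` returns on the diagonal. -/
theorem diagMoment_eq (j a b c : ι) :
    diagMoment j a b c = diagMoment j j j j / 6 * permCount ![a, b, c] ![a, b, c] := by
  have h0 : ∀ x, diagMoment j x x x = diagMoment j j j j := fun x => by
    simpa using diagMoment_perm j (Equiv.swap j x) j j j
  have h1 : ∀ {x y}, x ≠ y → diagMoment j x x y = diagMoment j j j j / 3 := fun {x y} h => by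
    rw [← h0 x, diagMoment_same j h]; ring
  have h2 : ∀ {x y z}, x ≠ y → z ≠ x → z ≠ y → diagMoment j x y z = diagMoment j j j j / 6 :=
    fun {x y z} h h' h'' => by
      have := diagMoment_pair j h h' h''
      rw [h1 h'.symm] at this
      linear_combination -this / 2
  rw [permCount_cons]
  by_cases hab : a = b
  · subst hab
    by_cases hac : a = c
    · subst hac; rw [h0]; simp; ring
    · rw [h1 hac]; simp [hac, Ne.symm hac]; ring
  · by_cases hac : a = c
    · subst hac
      rw [diagMoment_rotate, diagMoment_rotate, h1 hab]; simp [hab, Ne.symm hab]; ring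
    · by_cases hbc : b = c
      · subst hbc
        rw [diagMoment_rotate, h1 (Ne.symm hab)]; simp [hab, Ne.symm hab]; ring
      · rw [h2 hab (Ne.symm hac) (Ne.symm hbc)]; simp [hab, Ne.symm hab, hac, hbc, Ne.symm hac, Ne.symm hbc]

theorem colMoment_eq_mul_permCount (j : ι) (s t : Fin 3 → ι) :
    colMoment j s t = diagMoment j j j j / 6 * permCount s t := by
  by_cases h : ∃ π : Equiv.Perm (Fin 3), s = t ∘ π
  · obtain ⟨π, rfl⟩ := h
    -- Both sides ignore rearrangements of the second string, so it may be replaced by `t ∘ π`,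
    -- reducing to a diagonal moment.
    rw [← colMoment_comp_right j _ t π, ← permCount_comp_right _ t π]
    have := diagMoment_eq j ((t ∘ π) 0) ((t ∘ π) 1) ((t ∘ π) 2)
    rwa [diagMoment, ← (fin_three_eq_iff (t ∘ π) _ _ _).mpr ⟨rfl, rfl, rfl⟩] at this
  · push Not at h
    rw [colMoment_eq_zero j h, permCount, Finset.sum_eq_zero fun π _ => if_neg (h π), mul_zero]

/-- The column has unit norm, so summing over a shared last letter lowers the degree of the moment.
-/
theorem sum_colMoment_last (j a b a' b' : ι) :
    ∑ c, colMoment j ![a, b, c] ![a', b', c] =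
      haarAverage ι (entry a j * star (entry a' j) * (entry b j * star (entry b' j))) := by
  simp only [colMoment, Fin.prod_univ_three, cons_val, ← map_sum, ← Finset.mul_sum,
    sum_star_entry_mul_entry, if_true, mul_one]

theorem sum_permCount_last (a b a' b' : ι) :
    ∑ c, permCount ![a, b, c] ![a', b', c] = (Fintype.card ι + 2) *
      ((if a = a' ∧ b = b' then 1 else 0) + (if a = b' ∧ b = a' then 1 else 0)) := by
  simp only [permCount_cons, and_true, Finset.sum_add_distrib, Finset.sum_const,
    Finset.card_univ, nsmul_eq_mul]
  have h1 : ∀ (P : Prop) [Decidable P] (x y : ι),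
      (∑ c, if P ∧ x = c ∧ c = y then (1 : ℂ) else 0) = if P ∧ x = y then 1 else 0 := by
    intro P _ x y
    by_cases hP : P <;> simp [hP, ite_and]
  have h3 : ∀ (P : Prop) [Decidable P] (x y : ι),
      (∑ c, if x = c ∧ c = y ∧ P then (1 : ℂ) else 0) = if P ∧ x = y then 1 else 0 := by
    intro P _ x y
    by_cases hP : P <;> simp [hP, ite_and]
  simp only [h1, h3, and_comm (a := b = a'), and_comm (a := b = b')]
  ring

/-- Summing all diagonal moments gives 1 by normalization of the column, while `permCount` sums to
`d(d+1)(d+2)`. -/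
theorem diagMoment_self (j : ι) : diagMoment j j j j =
    6 / (Fintype.card ι * (Fintype.card ι + 1) * (Fintype.card ι + 2)) := by
  have h : ∑ a, ∑ b, ∑ c, colMoment j ![a, b, c] ![a, b, c] = 1 := by
    simp only [sum_colMoment_last, ← map_sum, ← Finset.mul_sum, sum_star_entry_mul_entry, if_true,
      mul_one, haarAverage_one]
  simp only [colMoment_eq_mul_permCount, ← Finset.mul_sum, sum_permCount_last, and_self, if_true,
    Finset.sum_add_distrib, Finset.sum_const, Finset.card_univ, nsmul_eq_mul, ite_and,
    Finset.sum_ite_eq, Finset.mem_univ] at h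
  simp at h
  have hd : (Fintype.card ι : ℂ) ≠ 0 := by
    rintro h0; simp [h0] at h
  have hd1 : (Fintype.card ι : ℂ) + 1 ≠ 0 := Nat.cast_add_one_ne_zero _
  have hd2 : (Fintype.card ι : ℂ) + 2 ≠ 0 := by
    exact_mod_cast (Fintype.card ι + 1).succ_ne_zero
  field_simp
  linear_combination 6 * h

theorem colMoment_eq (j : ι) (s t : Fin 3 → ι) :
    colMoment j s t =
      permCount s t / (Fintype.card ι * (Fintype.card ι + 1) * (Fintype.card ι + 2)) := by
  rw [colMoment_eq_mul_permCount, diagMoment_self]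
  ring

end Haar

/-! ### Tensor powers -/

theorem sum_fin_three_pi {ι M : Type*} [Fintype ι] [AddCommMonoid M] (f : (Fin 3 → ι) → M) :
    ∑ r, f r = ∑ a, ∑ b, ∑ c, f ![a, b, c] := by
  let e : ι × ι × ι ≃ (Fin 3 → ι) :=
    { toFun := fun x => ![x.1, x.2.1, x.2.2]
      invFun := fun r => (r 0, r 1, r 2)
      left_inv := fun _ => rfl
      right_inv := fun r => by ext i; fin_cases i <;> rfl }
  rw [← e.sum_comp f, Fintype.sum_prod_type]
  simp only [Fintype.sum_prod_type]
  rfl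

section TensorPow

variable {ι : Type*} {k : ℕ}

theorem tensorPow_mul [Fintype ι] (X Y : Matrix ι ι ℂ) :
    tensorPow k (X * Y) = tensorPow k X * tensorPow k Y := by
  classical
  ext s t
  simp only [tensorPow, of_apply, mul_apply, Finset.prod_univ_sum, Finset.prod_mul_distrib,
    Fintype.piFinset_univ]

theorem continuous_tensorPow {Ω : Type*} [TopologicalSpace Ω] {M : Ω → Matrix ι ι ℂ}
    (hM : Continuous M) : Continuous fun U => tensorPow k (M U) :=
  continuous_matrix fun s t =>
    show Continuous fun U => ∏ i, M U (s i) (t i) from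
      continuous_finsetProd _ fun _ _ => hM.matrix_elem _ _

end TensorPow

section TensorAB

variable {A B : Type*} {k : ℕ}

theorem tensorAB_apply (X : Matrix (Fin k → A) (Fin k → A) ℂ)
    (Y : Matrix (Fin k → B) (Fin k → B) ℂ) (s t : Fin k → A × B) :
    tensorAB X Y s t = X (fun i => (s i).1) (fun i => (t i).1) *
      Y (fun i => (s i).2) (fun i => (t i).2) := rfl

theorem tensorAB_add_left (X X' : Matrix (Fin k → A) (Fin k → A) ℂ)
    (Y : Matrix (Fin k → B) (Fin k → B) ℂ) :
    tensorAB (X + X') Y = tensorAB X Y + tensorAB X' Y := by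
  ext; simp [tensorAB_apply, add_mul]

theorem tensorAB_add_right (X : Matrix (Fin k → A) (Fin k → A) ℂ)
    (Y Y' : Matrix (Fin k → B) (Fin k → B) ℂ) :
    tensorAB X (Y + Y') = tensorAB X Y + tensorAB X Y' := by
  ext; simp [tensorAB_apply, mul_add]

/-- Splitting a string over `A × B` into a string over `A` and a string over `B`. -/
def splitEquiv (A B : Type*) (k : ℕ) : (Fin k → A × B) ≃ (Fin k → A) × (Fin k → B) :=
  Equiv.arrowProdEquivProdArrow _ _ _

theorem tensorAB_mul [Fintype A] [Fintype B] (X X' : Matrix (Fin k → A) (Fin k → A) ℂ)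
    (Y Y' : Matrix (Fin k → B) (Fin k → B) ℂ) :
    tensorAB X Y * tensorAB X' Y' = tensorAB (X * X') (Y * Y') := by
  unfold tensorAB
  rw [mul_kronecker_mul]
  exact submatrix_mul_equiv (X ⊗ₖ Y) (X' ⊗ₖ Y') _ (splitEquiv A B k) _

theorem tensorPow_kronecker (X : Matrix A A ℂ) (Y : Matrix B B ℂ) :
    tensorPow k (X ⊗ₖ Y) = tensorAB (tensorPow k X) (tensorPow k Y) := by
  ext s t
  simp [tensorPow, tensorAB_apply, Finset.prod_mul_distrib]

theorem permOp_prod [DecidableEq A] [DecidableEq B] (π : Equiv.Perm (Fin k)) :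
    permOp (A × B) π = tensorAB (permOp A π) (permOp B π) := by
  ext s t
  simp only [permOp, tensorAB_apply, of_apply, ite_mul, one_mul, zero_mul, ← ite_and]
  simp [funext_iff, Prod.ext_iff, forall_and]

end TensorAB

theorem mPlus_apply {ι : Type*} [DecidableEq ι] (s t : Fin 3 → ι) : mPlus ι s t =
    (if s 0 = t 1 ∧ s 1 = t 2 ∧ s 2 = t 0 then 1 else 0) +
    (if s 0 = t 2 ∧ s 1 = t 0 ∧ s 2 = t 1 then 1 else 0) := by
  have h : ∀ π : Equiv.Perm (Fin 3), t ∘ π = ![t (π 0), t (π 1), t (π 2)] := fun π => by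
    ext i; fin_cases i <;> rfl
  simp only [mPlus, w123, w132, permOp, Matrix.add_apply, of_apply, h, fin_three_eq_iff]
  rfl

/-! ### The Haar twirl of the diagonal observable -/

section Observable

variable {ι : Type*} [Fintype ι] [DecidableEq ι]

theorem oPlusCoeff_cons (a b c : ι) : oPlusCoeff ![a, b, c] =
    ((Fintype.card ι : ℂ) + 1) * ((Fintype.card ι : ℂ) + 2) * (if a = b ∧ b = c then 1 else 0)
    - ((Fintype.card ι : ℂ) + 1) *
      ((if a = b then 1 else 0) + (if b = c then 1 else 0) + (if a = c then 1 else 0)) + 2 :=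
  rfl

/-- Stated over a general algebra so that it applies to continuous functions on the group, where the
single sums become row orthogonality relations before any averaging. -/
theorem sum_oPlusCoeff_smul {R : Type*} [CommRing R] [Algebra ℂ R] (g : Fin 3 → ι → R) :
    ∑ r, oPlusCoeff r • ∏ i, g i (r i) =
      (((Fintype.card ι : ℂ) + 1) * ((Fintype.card ι : ℂ) + 2)) • ∑ a, g 0 a * g 1 a * g 2 a
      - ((Fintype.card ι : ℂ) + 1) • ((∑ a, g 0 a * g 1 a) * ∑ b, g 2 b
        + (∑ a, g 1 a * g 2 a) * (∑ b, g 0 b) + (∑ a, g 0 a * g 2 a) * ∑ b, g 1 b)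
      + (2 : ℂ) • ((∑ a, g 0 a) * (∑ a, g 1 a) * ∑ a, g 2 a) := by
  rw [sum_fin_three_pi]
  simp only [oPlusCoeff_cons, Fin.prod_univ_three, cons_val, add_smul, sub_smul, mul_smul, ite_smul,
    one_smul, zero_smul, Finset.sum_add_distrib, Finset.sum_sub_distrib, ← Finset.smul_sum]
  have h1 : ∑ a, ∑ b, ∑ c, (if a = b ∧ b = c then g 0 a * g 1 b * g 2 c else 0) =
      ∑ a, g 0 a * g 1 a * g 2 a := by
    simp [ite_and]
  have h2 : ∑ a, ∑ b, ∑ c, (if a = b then g 0 a * g 1 b * g 2 c else 0) =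
      (∑ a, g 0 a * g 1 a) * ∑ b, g 2 b := by
    simp [← Finset.mul_sum, Finset.sum_mul]
  have h3 : ∑ a, ∑ b, ∑ c, (if b = c then g 0 a * g 1 b * g 2 c else 0) =
      (∑ a, g 1 a * g 2 a) * ∑ b, g 0 b := by
    simp [mul_assoc, ← Finset.mul_sum, ← Finset.sum_mul, mul_comm]
  have h4 : ∑ a, ∑ b, ∑ c, (if a = c then g 0 a * g 1 b * g 2 c else 0) =
      (∑ a, g 0 a * g 2 a) * ∑ b, g 1 b := by
    simp only [Finset.sum_ite_eq, Finset.mem_univ, if_true, ← Finset.mul_sum, ← Finset.sum_mul]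
    rw [Finset.sum_mul]
    exact Finset.sum_congr rfl fun _ _ => mul_right_comm _ _ _
  have h5 : ∑ a, ∑ b, ∑ c, g 0 a * g 1 b * g 2 c =
      (∑ a, g 0 a) * (∑ a, g 1 a) * ∑ a, g 2 a := by
    simp only [← Finset.mul_sum, ← Finset.sum_mul]
  rw [h1, h2, h3, h4, h5]

/-- Summing out the last letter of the third moment produces a factor `d + 2`, which cancels the one
in its denominator. -/
theorem haarAverage_pair (j a b a' b' : ι) :
    haarAverage ι (entry a j * star (entry a' j) * (entry b j * star (entry b' j))) =
      ((if a = a' ∧ b = b' then 1 else 0) + (if a = b' ∧ b = a' then 1 else 0)) /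
        (Fintype.card ι * (Fintype.card ι + 1)) := by
  have hd2 : (Fintype.card ι : ℂ) + 2 ≠ 0 := by
    exact_mod_cast (Fintype.card ι + 1).succ_ne_zero
  rw [← sum_colMoment_last]
  simp only [colMoment_eq, ← Finset.sum_div, sum_permCount_last]
  field_simp

theorem twirl_integrand_eq (c : (Fin 3 → ι) → ℂ) (s t : Fin 3 → ι) (U : unitaryGroup ι ℂ) :
    (tensorPow 3 (U : Matrix ι ι ℂ) * Matrix.diagonal c * tensorPow 3 (U : Matrix ι ι ℂ)ᴴ) s t =
      (∑ r, c r • ∏ i, (entry (s i) (r i) * star (entry (t i) (r i)))) U := by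
  rw [mul_apply]
  simp only [mul_diagonal, tensorPow, of_apply, conjTranspose_apply, ContinuousMap.sum_apply,
    ContinuousMap.smul_apply, ContinuousMap.prod_apply, ContinuousMap.mul_apply,
    ContinuousMap.star_apply, entry_apply, Finset.prod_mul_distrib, smul_eq_mul]
  exact Finset.sum_congr rfl fun r _ => by ring

theorem twirl_haarUnitary_oPlus : twirl 3 (haarUnitary ι) (oPlus ι) = mPlus ι := by
  ext s t
  have hne : (Fintype.card ι : ℂ) ≠ 0 := by
    have : Nonempty ι := ⟨s 0⟩
    exact_mod_cast Fintype.card_ne_zero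
  have hd1 : (Fintype.card ι : ℂ) + 1 ≠ 0 := Nat.cast_add_one_ne_zero _
  have hd2 : (Fintype.card ι : ℂ) + 2 ≠ 0 := by
    exact_mod_cast (Fintype.card ι + 1).succ_ne_zero
  have h1 : ∀ a, haarAverage ι (entry (s 0) a * star (entry (t 0) a) *
      (entry (s 1) a * star (entry (t 1) a)) * (entry (s 2) a * star (entry (t 2) a))) =
      colMoment a s t := fun a => by rw [colMoment, Fin.prod_univ_three]
  simp only [twirl, oPlus, of_apply, twirl_integrand_eq]
  rw [← haarAverage_apply,
    sum_oPlusCoeff_smul (fun i a => entry (s i) a * star (entry (t i) a))]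
  simp only [sum_entry_mul_star_entry, map_add, map_sub, map_smul, map_sum, mul_ite, mul_one,
    mul_zero, apply_ite (haarAverage ι), haarAverage_pair, h1, haarAverage_one, map_zero,
    colMoment_eq, permCount_eq, mPlus_apply, Finset.sum_const, Finset.card_univ, smul_eq_mul,
    nsmul_eq_mul]
  -- Splitting conjunctions into products lets the position-wise deltas `s i = t i` be evaluated by
  -- cases; the identity and transposition terms then cancel.
  have hand : ∀ (P Q : Prop) [Decidable P] [Decidable Q], (if P ∧ Q then (1 : ℂ) else 0) =
      (if P then 1 else 0) * (if Q then 1 else 0) := fun P Q _ _ => by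
    split_ifs <;> simp_all
  simp only [hand]
  by_cases e0 : s 0 = t 0 <;> by_cases e1 : s 1 = t 1 <;> by_cases e2 : s 2 = t 2 <;>
    simp only [e0, e1, e2, if_true, if_false] <;> field_simp <;> ring

end Observable

/-! ### The adjoint twirling map -/

section Adjoint

/-- The entrywise integral of a matrix-valued function pairs with the trace. -/
theorem integral_trace_mul {Ω n : Type*} [Fintype n] [TopologicalSpace Ω] [CompactSpace Ω]
    [MeasurableSpace Ω] [OpensMeasurableSpace Ω] (μ : Measure Ω) [IsFiniteMeasure μ]
    {M : Ω → Matrix n n ℂ} (hM : Continuous M) (Y : Matrix n n ℂ) :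
    ∫ U, (M U * Y).trace ∂μ = ((Matrix.of fun s t => ∫ U, M U s t ∂μ) * Y).trace := by
  simp only [trace, diag_apply, mul_apply, of_apply]
  have hint : ∀ s t, Integrable (fun U => M U s t * Y t s) μ := fun s t =>
    (integrable_of_continuous μ (hM.matrix_elem s t)).mul_const _
  rw [integral_finsetSum _ fun s _ => integrable_finsetSum _ fun t _ => hint s t]
  refine Finset.sum_congr rfl fun s _ => ?_
  rw [integral_finsetSum _ fun t _ => hint s t]
  exact Finset.sum_congr rfl fun t _ => integral_mul_const _ _

variable {ι : Type*} [Fintype ι] [DecidableEq ι]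

/-- The adjoint `X ↦ 𝔼_{U ∼ μ} (U†)^{⊗k} X U^{⊗k}` of the twirling map. -/
def adjointTwirl (k : ℕ) (μ : Measure (unitaryGroup ι ℂ))
    (X : Matrix (Fin k → ι) (Fin k → ι) ℂ) : Matrix (Fin k → ι) (Fin k → ι) ℂ :=
  Matrix.of fun s t =>
    ∫ U, (tensorPow k (U : Matrix ι ι ℂ)ᴴ * X * tensorPow k (U : Matrix ι ι ℂ)) s t ∂μ

omit [DecidableEq ι] in
theorem continuous_conj_tensorPow {Ω : Type*} [TopologicalSpace Ω] {k : ℕ}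
    {V W : Ω → Matrix ι ι ℂ} (hV : Continuous V) (hW : Continuous W)
    (X : Matrix (Fin k → ι) (Fin k → ι) ℂ) :
    Continuous fun U => tensorPow k (V U) * X * tensorPow k (W U) :=
  ((continuous_tensorPow hV).matrix_mul continuous_const).matrix_mul (continuous_tensorPow hW)

/-- The substitution `U ↦ U⁻¹ = U†` exchanges the two twirls. -/
theorem adjointTwirl_haarUnitary (k : ℕ) (X : Matrix (Fin k → ι) (Fin k → ι) ℂ) :
    adjointTwirl k (haarUnitary ι) X = twirl k (haarUnitary ι) X := by
  ext s t
  have hc : Continuous fun U : unitaryGroup ι ℂ =>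
      (tensorPow k (U : Matrix ι ι ℂ) * X * tensorPow k (U : Matrix ι ι ℂ)ᴴ) s t :=
    (continuous_conj_tensorPow continuous_subtype_val
      continuous_subtype_val.matrix_conjTranspose X).matrix_elem s t
  simp only [adjointTwirl, twirl, of_apply]
  rw [← integral_haarUnitary_inv hc]
  simp [star_eq_conjTranspose]

theorem trace_adjointTwirl_mul (k : ℕ) (μ : Measure (unitaryGroup ι ℂ)) [IsFiniteMeasure μ]
    (X Y : Matrix (Fin k → ι) (Fin k → ι) ℂ) :
    (adjointTwirl k μ X * Y).trace = (twirl k μ Y * X).trace := by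
  rw [adjointTwirl, twirl, ← integral_trace_mul, ← integral_trace_mul]
  · refine integral_congr_ae (.of_forall fun U => ?_)
    simpa only [mul_assoc] using trace_mul_comm (tensorPow k (U : Matrix ι ι ℂ)ᴴ * X)
      (tensorPow k (U : Matrix ι ι ℂ) * Y)
  · exact continuous_conj_tensorPow continuous_subtype_val
      continuous_subtype_val.matrix_conjTranspose Y
  · exact continuous_conj_tensorPow continuous_subtype_val.matrix_conjTranspose
      continuous_subtype_val X

/-- The design condition concerns only `twirl`. Pairing with an arbitrary `Y` under the trace moves
the twirl onto `Y`, where the condition applies, and Haar twirling is its own adjoint. -/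
theorem IsUnitaryDesign.adjointTwirl_eq {k : ℕ} {μ : Measure (unitaryGroup ι ℂ)}
    (hμ : IsUnitaryDesign k μ) (X : Matrix (Fin k → ι) (Fin k → ι) ℂ) :
    adjointTwirl k μ X = twirl k (haarUnitary ι) X := by
  have := hμ.isProbabilityMeasure
  rw [← adjointTwirl_haarUnitary]
  refine ext_iff_trace_mul_right.mpr fun Y => ?_
  rw [trace_adjointTwirl_mul, trace_adjointTwirl_mul, hμ.twirl_eq]

end Adjoint

/-! ### Post-processing of outcome probabilities -/

section Outcome

variable {ι : Type*} [Fintype ι] [DecidableEq ι]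

theorem outcomeProb_eq (ρ U : Matrix ι ι ℂ) (s : ι) : outcomeProb ρ U s = (U * ρ * Uᴴ) s s := by
  simp [outcomeProb, trace_single_mul]

/-- Cyclicity of the trace moves the conjugation from the state to the observable, in the Heisenberg
picture. -/
theorem sum_mul_prod_outcomeProb (c : (Fin 3 → ι) → ℂ) (ρ U : Matrix ι ι ℂ) :
    ∑ s, c s * ∏ i, outcomeProb ρ U (s i) =
      (tensorPow 3 Uᴴ * Matrix.diagonal c * tensorPow 3 U * tensorPow 3 ρ).trace := by
  have h : ∀ s : Fin 3 → ι, ∏ i, outcomeProb ρ U (s i) =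
      (tensorPow 3 U * tensorPow 3 ρ * tensorPow 3 Uᴴ) s s := fun s => by
    simp only [← tensorPow_mul, outcomeProb_eq]; rfl
  simp only [mul_assoc]
  rw [trace_mul_comm]
  simp only [mul_assoc, trace, diag_apply, diagonal_mul, h]

theorem continuous_prod_outcomeProb {Ω : Type*} [TopologicalSpace Ω] {M : Ω → Matrix ι ι ℂ}
    (hM : Continuous M) (ρ : Matrix ι ι ℂ) (s : Fin 3 → ι) :
    Continuous fun U => ∏ i, outcomeProb ρ (M U) (s i) := by
  simp only [outcomeProb_eq]
  exact continuous_finsetProd _ fun i _ =>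
    ((hM.matrix_mul continuous_const).matrix_mul hM.matrix_conjTranspose).matrix_elem _ _

theorem sum_mul_globalOmega (μ : Measure (unitaryGroup ι ℂ)) [IsFiniteMeasure μ]
    (c : (Fin 3 → ι) → ℂ) (ρ : Matrix ι ι ℂ) :
    ∑ s, c s * globalOmega μ ρ s =
      (adjointTwirl 3 μ (Matrix.diagonal c) * tensorPow 3 ρ).trace := by
  simp only [globalOmega, ← integral_const_mul]
  rw [← integral_finsetSum, adjointTwirl, ← integral_trace_mul]
  · simp only [sum_mul_prod_outcomeProb]
  · exact continuous_conj_tensorPow continuous_subtype_val.matrix_conjTranspose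
      continuous_subtype_val _
  · exact fun s _ => (integrable_of_continuous μ
      (continuous_prod_outcomeProb continuous_subtype_val ρ s)).const_mul _

end Outcome

/-! ### Independent local unitaries on a bipartite system -/

section Bilocal

variable {A B : Type*} [Fintype A] [DecidableEq A] [Fintype B] [DecidableEq B]

theorem bilocalTwirl_tensorAB (k : ℕ) (μA : Measure (unitaryGroup A ℂ))
    (μB : Measure (unitaryGroup B ℂ)) [SFinite μA] [SFinite μB]
    (X : Matrix (Fin k → A) (Fin k → A) ℂ) (Y : Matrix (Fin k → B) (Fin k → B) ℂ) :
    bilocalTwirl k μA μB (tensorAB X Y) = tensorAB (twirl k μA X) (twirl k μB Y) := by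
  ext s t
  simp only [bilocalTwirl, twirl, conjTranspose_kronecker, tensorPow_kronecker, tensorAB_mul,
    tensorAB_apply, of_apply]
  exact integral_prod_mul
    (fun U : unitaryGroup A ℂ => (tensorPow k (U : Matrix A A ℂ) * X *
      tensorPow k (U : Matrix A A ℂ)ᴴ) (fun i => (s i).1) fun i => (t i).1)
    (fun V : unitaryGroup B ℂ => (tensorPow k (V : Matrix B B ℂ) * Y *
      tensorPow k (V : Matrix B B ℂ)ᴴ) (fun i => (s i).2) fun i => (t i).2)

omit [Fintype A] [Fintype B] in
theorem diagonal_tensorAB {k : ℕ} (f : (Fin k → A) → ℂ) (g : (Fin k → B) → ℂ) :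
    tensorAB (Matrix.diagonal f) (Matrix.diagonal g) =
      Matrix.diagonal fun s : Fin k → A × B => f (fun i => (s i).1) * g (fun i => (s i).2) := by
  unfold tensorAB
  rw [diagonal_kronecker_diagonal]
  exact submatrix_diagonal _ _ (splitEquiv A B k).injective

theorem continuous_kronecker_coe : Continuous fun U : unitaryGroup A ℂ × unitaryGroup B ℂ =>
    (U.1 : Matrix A A ℂ) ⊗ₖ (U.2 : Matrix B B ℂ) :=
  continuous_matrix fun i j =>
    ((continuous_subtype_val.comp continuous_fst).matrix_elem i.1 j.1).mul
      ((continuous_subtype_val.comp continuous_snd).matrix_elem i.2 j.2)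

theorem sum_mul_bilocalOmega (μA : Measure (unitaryGroup A ℂ)) (μB : Measure (unitaryGroup B ℂ))
    [IsFiniteMeasure μA] [IsFiniteMeasure μB] (f : (Fin 3 → A) → ℂ) (g : (Fin 3 → B) → ℂ)
    (ρ : Matrix (A × B) (A × B) ℂ) :
    ∑ a, ∑ b, f a * g b * bilocalOmega μA μB ρ a b =
      (tensorAB (adjointTwirl 3 μA (Matrix.diagonal f)) (adjointTwirl 3 μB (Matrix.diagonal g)) *
        tensorPow 3 ρ).trace := by
  have hM := continuous_kronecker_coe (A := A) (B := B)
  have hsum : ∑ a, ∑ b, f a * g b * bilocalOmega μA μB ρ a b =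
      ∑ s : Fin 3 → A × B, ∫ U, f (fun i => (s i).1) * g (fun i => (s i).2) *
        ∏ i, outcomeProb ρ ((U.1 : Matrix A A ℂ) ⊗ₖ (U.2 : Matrix B B ℂ)) (s i)
          ∂(μA.prod μB) := by
    rw [← Fintype.sum_prod_type', ← (splitEquiv A B 3).sum_comp]
    simp only [integral_const_mul]
    rfl
  -- Independence: the product of the two local averages is one average over the product measure.
  have hadj : tensorAB (adjointTwirl 3 μA (Matrix.diagonal f))
      (adjointTwirl 3 μB (Matrix.diagonal g)) = Matrix.of fun s t =>
        ∫ U, (tensorPow 3 ((U.1 : Matrix A A ℂ) ⊗ₖ (U.2 : Matrix B B ℂ))ᴴ *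
          tensorAB (Matrix.diagonal f) (Matrix.diagonal g) *
          tensorPow 3 ((U.1 : Matrix A A ℂ) ⊗ₖ (U.2 : Matrix B B ℂ))) s t ∂(μA.prod μB) := by
    ext s t
    simp only [adjointTwirl, conjTranspose_kronecker, tensorPow_kronecker, tensorAB_mul,
      tensorAB_apply, of_apply]
    exact (integral_prod_mul
      (fun U : unitaryGroup A ℂ => (tensorPow 3 (U : Matrix A A ℂ)ᴴ * Matrix.diagonal f *
        tensorPow 3 (U : Matrix A A ℂ)) (fun i => (s i).1) fun i => (t i).1)
      (fun V : unitaryGroup B ℂ => (tensorPow 3 (V : Matrix B B ℂ)ᴴ * Matrix.diagonal g *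
        tensorPow 3 (V : Matrix B B ℂ)) (fun i => (s i).2) fun i => (t i).2)).symm
  rw [hsum, hadj, ← integral_trace_mul _ (continuous_conj_tensorPow hM.matrix_conjTranspose hM _),
    ← integral_finsetSum]
  · simp only [diagonal_tensorAB, ← sum_mul_prod_outcomeProb]
  · exact fun s _ => (integrable_of_continuous _
      (continuous_prod_outcomeProb hM ρ s)).const_mul _

/-! ### The negativity operator -/

omit [Fintype A] [Fintype B] in
-- The product expands into four pairs of cycles; the two aligned ones form `M_+` of the composite
-- system, because permuting copies of `AB` permutes both factors alike.
theorem half_smul_tensorAB_mPlus_sub :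
    (1 / 2 : ℂ) • (tensorAB (mPlus A) (mPlus B) - mPlus (A × B)) = mNeg A B := by
  simp only [mPlus, mNeg, w123, w132, permOp_prod, tensorAB_add_left, tensorAB_add_right]
  congr 1
  abel

theorem trace_tensorAB_permOp_mul (π σ : Equiv.Perm (Fin 3)) (ρ : Matrix (A × B) (A × B) ℂ) :
    (tensorAB (permOp A π) (permOp B σ) * tensorPow 3 ρ).trace =
      ∑ s : Fin 3 → A × B, ∏ i, ρ (s i) ((s (π i)).1, (s (σ i)).2) := by
  have h : ∀ s t : Fin 3 → A × B, tensorAB (permOp A π) (permOp B σ) t s =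
      if t = fun i => ((s (π i)).1, (s (σ i)).2) then 1 else 0 := fun s t => by
    simp only [permOp, tensorAB_apply, of_apply, ite_mul, one_mul, zero_mul, ← ite_and]
    simp [funext_iff, Prod.ext_iff, forall_and]
  rw [trace_mul_comm]
  simp only [trace, diag_apply, mul_apply, h, mul_ite, mul_one, mul_zero, Finset.sum_ite_eq',
    Finset.mem_univ, if_true, tensorPow, of_apply]

/-- Permuting the `A`-letters and the `B`-letters of a string over `A × B`. -/
def permLetters (α β : Equiv.Perm (Fin 3)) : (Fin 3 → A × B) ≃ (Fin 3 → A × B) :=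
  (splitEquiv A B 3).trans (((α.symm.arrowCongr (Equiv.refl A)).prodCongr
    (β.symm.arrowCongr (Equiv.refl B))).trans (splitEquiv A B 3).symm)

theorem trace_pow_three {n : Type*} [Fintype n] [DecidableEq n] (M : Matrix n n ℂ) :
    (M ^ 3).trace = ∑ s : Fin 3 → n, M (s 0) (s 1) * M (s 1) (s 2) * M (s 2) (s 0) := by
  rw [sum_fin_three_pi, pow_three]
  simp only [trace, diag_apply, mul_apply, Finset.mul_sum, cons_val, mul_assoc]

theorem trace_mNeg_mul_tensorPow (ρ : Matrix (A × B) (A × B) ℂ) :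
    (mNeg A B * tensorPow 3 ρ).trace = (partialTranspose ρ ^ 3).trace := by
  have h1 : (tensorAB (w123 A) (w132 B) * tensorPow 3 ρ).trace =
      (partialTranspose ρ ^ 3).trace := by
    rw [w123, w132, trace_tensorAB_permOp_mul, trace_pow_three]
    -- The `A`-letters already run in the order of the matrix product; shifting the `B`-letters by
    -- one place matches the transposed indices.
    refine Fintype.sum_equiv (permLetters 1 c[0, 2, 1]) _ _ fun s => ?_
    rw [Fin.prod_univ_three]
    rfl
  have h2 : (tensorAB (w132 A) (w123 B) * tensorPow 3 ρ).trace =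
      (partialTranspose ρ ^ 3).trace := by
    rw [w123, w132, trace_tensorAB_permOp_mul, trace_pow_three]
    -- Here the `A`-cycle runs backwards. Exchanging letters 1 and 2 of `A` reverses it, which also
    -- interchanges the last two factors; the `B`-letters follow by exchanging 0 and 1.
    refine Fintype.sum_equiv (permLetters (Equiv.swap 1 2) (Equiv.swap 0 1)) _ _ fun s => ?_
    rw [Fin.prod_univ_three, mul_right_comm]
    rfl
  rw [mNeg, smul_mul, add_mul, trace_smul, trace_add, h1, h2, smul_eq_mul]
  ring

end Bilocal

end

end NegMoment

theorem mainTheorem3 {A B : Type*} [Fintype A] [DecidableEq A] [Fintype B] [DecidableEq B]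
    (μA : Measure (unitaryGroup A ℂ)) (μB : Measure (unitaryGroup B ℂ))
    (μAB : Measure (unitaryGroup (A × B) ℂ))
    (hA : NegMoment.IsUnitaryDesign 3 μA) (hB : NegMoment.IsUnitaryDesign 3 μB)
    (hAB : NegMoment.IsUnitaryDesign 3 μAB) :
    -- single-party realization
    NegMoment.twirl 3 μA (NegMoment.oPlus A) = NegMoment.mPlus A ∧
    NegMoment.twirl 3 μB (NegMoment.oPlus B) = NegMoment.mPlus B ∧
    -- bi-local realization
    NegMoment.bilocalTwirl 3 μA μB (NegMoment.tensorAB (NegMoment.oPlus A) (NegMoment.oPlus B)) =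
      NegMoment.tensorAB (NegMoment.mPlus A) (NegMoment.mPlus B) ∧
    -- global realization
    NegMoment.twirl 3 μAB (NegMoment.oPlus (A × B)) = NegMoment.mPlus (A × B) ∧
    -- half the difference is the negativity operator
    (1 / 2 : ℂ) • (NegMoment.bilocalTwirl 3 μA μB
          (NegMoment.tensorAB (NegMoment.oPlus A) (NegMoment.oPlus B)) -
        NegMoment.twirl 3 μAB (NegMoment.oPlus (A × B))) = NegMoment.mNeg A B ∧
    -- it yields the negativity moment of every state, both as an expectation value on three
    -- copies and by post-processing the single-copy outcome probabilities
    ∀ ρ : Matrix (A × B) (A × B) ℂ, NegMoment.IsState ρ →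
      (((1 / 2 : ℂ) • (NegMoment.bilocalTwirl 3 μA μB
            (NegMoment.tensorAB (NegMoment.oPlus A) (NegMoment.oPlus B)) -
          NegMoment.twirl 3 μAB (NegMoment.oPlus (A × B)))) *
          NegMoment.tensorPow 3 ρ).trace = (NegMoment.partialTranspose ρ ^ 3).trace ∧
      (1 / 2 : ℂ) *
          ((∑ a : Fin 3 → A, ∑ b : Fin 3 → B, NegMoment.oPlusCoeff a * NegMoment.oPlusCoeff b *
              NegMoment.bilocalOmega μA μB ρ a b) -
            ∑ c : Fin 3 → A × B, NegMoment.oPlusCoeff c * NegMoment.globalOmega μAB ρ c) =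
        (NegMoment.partialTranspose ρ ^ 3).trace := by

  have := hA.isProbabilityMeasure
  have := hB.isProbabilityMeasure
  have := hAB.isProbabilityMeasure
  have h1 : NegMoment.twirl 3 μA (NegMoment.oPlus A) = NegMoment.mPlus A :=
    (hA.twirl_eq _).trans NegMoment.twirl_haarUnitary_oPlus
  have h2 : NegMoment.twirl 3 μB (NegMoment.oPlus B) = NegMoment.mPlus B :=
    (hB.twirl_eq _).trans NegMoment.twirl_haarUnitary_oPlus
  have h3 := NegMoment.bilocalTwirl_tensorAB 3 μA μB (NegMoment.oPlus A) (NegMoment.oPlus B)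
  rw [h1, h2] at h3
  have h4 : NegMoment.twirl 3 μAB (NegMoment.oPlus (A × B)) = NegMoment.mPlus (A × B) :=
    (hAB.twirl_eq _).trans NegMoment.twirl_haarUnitary_oPlus
  have h5 := NegMoment.half_smul_tensorAB_mPlus_sub (A := A) (B := B)
  refine ⟨h1, h2, h3, h4, by rw [h3, h4, h5], fun ρ _ => ⟨?_, ?_⟩⟩
  · rw [h3, h4, h5, NegMoment.trace_mNeg_mul_tensorPow]
  -- The post-processed statistics are traces against adjoint twirls, which for designs take the
  -- same values as the Haar twirls.
  · have hA' : NegMoment.adjointTwirl 3 μA (Matrix.diagonal NegMoment.oPlusCoeff) =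
        NegMoment.mPlus A := (hA.adjointTwirl_eq _).trans NegMoment.twirl_haarUnitary_oPlus
    have hB' : NegMoment.adjointTwirl 3 μB (Matrix.diagonal NegMoment.oPlusCoeff) =
        NegMoment.mPlus B := (hB.adjointTwirl_eq _).trans NegMoment.twirl_haarUnitary_oPlus
    have hAB' : NegMoment.adjointTwirl 3 μAB (Matrix.diagonal NegMoment.oPlusCoeff) =
        NegMoment.mPlus (A × B) :=
      (hAB.adjointTwirl_eq _).trans NegMoment.twirl_haarUnitary_oPlus
    rw [NegMoment.sum_mul_bilocalOmega, NegMoment.sum_mul_globalOmega, hA', hB', hAB',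
      ← Matrix.trace_sub, ← sub_mul, ← smul_eq_mul, ← Matrix.trace_smul, ← Matrix.smul_mul, h5,
      NegMoment.trace_mNeg_mul_tensorPow]
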